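/- Let $n\ge 2$ and let $M,N\subset\mathbb R^n$ be smooth ($C^\infty$) compact hypersurfaces which are the boundaries of bounded strictly convex domains (the closures of the domains are strictly convex); let $n_M$, $n_N$ be their outer unit normal fields. Let $\mu=f\,dv_M$ and $\nu=g\,dv_N$ be probability measures, where $dv_M,dv_N$ are the volume measures of $M,N$ and $f:M\to\mathbb R$, $g:N\to\mathbb R$ are continuous and (strictly) positive everywhere. Put $c(x,y)=\tfrac12|x-y|^2$. Let $(\varphi,\psi)\in C^0(M)\times C^0(N)$ maximize $\int_M\varphi\,d\mu+\int_N\psi\,d\nu$ among all pairs of continuous functions with $\varphi(x)+\psi(y)\le c(x,y)$ for all $(x,y)\in M\times N$, and suppose that $$\psi(y)=\inf_{z\in M}\bigl(c(z,y)-\varphi(z)\bigr)\quad(y\in N),\qquad \varphi(x)=\inf_{z\in N}\bigl(c(x,z)-\psi(z)\bigr)\quad(x\in M).$$ For $y\in N$ let $\Theta_y:M\to\mathbb R$, $\Theta_y(x)=c(x,y)-\varphi(x)$, and let $$\Gamma=\{x\in M:\ \Theta_y(x)=\sup_M\Theta_y\ \text{for some } y\in N\}.$$ Then for every $x\in\Gamma$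 there is exactly one $y\in N$ with $\Theta_y(x)=\sup_M\Theta_y$; writing $T(x)$ for it, the map $T:\Gamma\to N$ is continuous and surjective, and for every $x\in\Gamma$ $$n_M(x)\cdot n_N(T(x))<0 .$$ Moreover, for every $x\in\Gamma$, $\varphi$ is differentiable at $x$ along $M$, and with $\nabla\varphi(x)\in T_xM$ its tangential gradient, the line $D_x=x-\nabla\varphi(x)+\mathrm{span}(n_M(x))$ meets $N$ in exactly two distinct points, namely $T(x)$ and a point $y'$ such that $x$ is a minimum of $\Theta_{y'}$ on $M$ and $$n_M(x)\cdot n_N(y')>0 .$$ -/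

import Mathlib

open MeasureTheory Set Topology
open scoped ContDiff

noncomputable section

namespace QuadraticTransport

/-- Euclidean space of dimension `n` with its standard norm and scalar product. -/
abbrev Euc (n : ℕ) : Type := EuclideanSpace ℝ (Fin n)

variable {n : ℕ}

/-- `M` is a smooth (embedded) hypersurface: near each of its points it is the zero set of a smooth
function with nowhere vanishing differential. -/
def IsSmoothHypersurface (M : Set (Euc n)) : Prop :=
  ∀ p ∈ M, ∃ (W : Set (Euc n)) (ρ : Euc n → ℝ), IsOpen W ∧ p ∈ W ∧ ContDiffOn ℝ ∞ ρ W ∧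
    (∀ x ∈ W, fderiv ℝ ρ x ≠ 0) ∧ M ∩ W = {x ∈ W | ρ x = 0}

/-- A bounded strictly convex domain with smooth boundary. Strict convexity is required of the
closure (for an open set `StrictConvex` is the same as `Convex`): the boundary contains no
segment. -/
structure IsSmoothStrictlyConvexDomain (U : Set (Euc n)) : Prop where
  isOpen : IsOpen U
  nonempty : U.Nonempty
  isBounded : Bornology.IsBounded U
  convex : Convex ℝ U
  strictConvex_closure : StrictConvex ℝ (closure U)
  smooth_frontier : IsSmoothHypersurface (frontier U)

/-- The tangent space of `M` at `x`. -/
def tangentSpaceOf (M : Set (Euc n)) (x : Euc n) : Submodule ℝ (Euc n) :=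
  Submodule.span ℝ (tangentConeAt ℝ M x)

/-- `v` is a unit vector normal to the boundary of `U` at `x` and pointing out of `U`. -/
def IsOuterUnitNormal (U : Set (Euc n)) (x v : Euc n) : Prop :=
  ‖v‖ = 1 ∧ v ∈ (tangentSpaceOf (frontier U) x)ᗮ ∧ ∀ᶠ t : ℝ in 𝓝[>] 0, x + t • v ∉ closure U

/-- The outer unit normal vector to the boundary of `U` at `x`. -/
def outerNormal (U : Set (Euc n)) (x : Euc n) : Euc n :=
  Classical.epsilon (IsOuterUnitNormal U x)

/-- `v` is the gradient at `x` of the restriction of `φ` to the hypersurface `M`: it is tangent to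
`M` at `x` and `φ z = φ x + ⟪v, z - x⟫ + o(‖z - x‖)` as `z → x` in `M`. -/
def IsTangentialGradient (M : Set (Euc n)) (φ : Euc n → ℝ) (x v : Euc n) : Prop :=
  v ∈ tangentSpaceOf M x ∧ HasGradientWithinAt φ v M x

/-- The gradient at `x` of the restriction of `φ` to the hypersurface `M`. -/
def tangentialGradient (M : Set (Euc n)) (φ : Euc n → ℝ) (x : Euc n) : Euc n :=
  Classical.epsilon (IsTangentialGradient M φ x)

/-- The quadratic cost. -/
def cost (x y : Euc n) : ℝ := 1 / 2 * ‖x - y‖ ^ 2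

/-- The measure `f dv`, where `dv` is the volume measure of the hypersurface `M`. -/
def densityMeasure (M : Set (Euc n)) (f : Euc n → ℝ) : Measure (Euc n) :=
  ((μHE[n - 1] : Measure (Euc n)).restrict M).withDensity fun x => ENNReal.ofReal (f x)

/-- Admissible pairs of the dual problem. Only the values of `φ` on `M` and of `ψ` on `N`
matter. -/
def IsAdmissible (M N : Set (Euc n)) (φ ψ : Euc n → ℝ) : Prop :=
  ContinuousOn φ M ∧ ContinuousOn ψ N ∧ ∀ x ∈ M, ∀ y ∈ N, φ x + ψ y ≤ cost x y

/-- The Kantorovich dual functional. -/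
def dualFunctional (M N : Set (Euc n)) (μ ν : Measure (Euc n)) (φ ψ : Euc n → ℝ) : ℝ :=
  (∫ x in M, φ x ∂μ) + ∫ y in N, ψ y ∂ν

/-- `(φ, ψ)` maximizes the Kantorovich dual problem, and `ψ = φ*` on `N`, `φ = ψ*` on `M`. -/
structure IsConjugateOptimalPair (M N : Set (Euc n)) (μ ν : Measure (Euc n))
    (φ ψ : Euc n → ℝ) : Prop where
  admissible : IsAdmissible M N φ ψ
  maximal : ∀ φ' ψ' : Euc n → ℝ, IsAdmissible M N φ' ψ' →
    dualFunctional M N μ ν φ' ψ' ≤ dualFunctional M N μ ν φ ψ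
  eq_conj_left : ∀ y ∈ N, ψ y = ⨅ z : M, (cost (z : Euc n) y - φ z)
  eq_conj_right : ∀ x ∈ M, φ x = ⨅ z : N, (cost x (z : Euc n) - ψ z)

/-- The function `Θ_y`. -/
def Theta (φ : Euc n → ℝ) (y x : Euc n) : ℝ := cost x y - φ x

/-- The set `Γ` of the points of `M` at which `Θ_y` attains its maximum over `M` for some
`y ∈ N`. -/
def Gam (M N : Set (Euc n)) (φ : Euc n → ℝ) : Set (Euc n) :=
  {x ∈ M | ∃ y ∈ N, IsMaxOn (Theta φ y) M x}

/-- The line `D_x = x - ∇φ(x) + span (n_M(x))`, where `M` is the boundary of `U`. -/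
def normalLine (U : Set (Euc n)) (φ : Euc n → ℝ) (x : Euc n) : Set (Euc n) :=
  {z | ∃ t : ℝ, z = x - tangentialGradient (frontier U) φ x + t • outerNormal U x}

end QuadraticTransport

end

namespace QuadraticTransport

open Filter

variable {n : ℕ}

/-! Let `x` maximize `Θ_y`. Conjugacy and compactness give a contact point `y'`, that is `φ x + ψ y'
= cost x y'`, so `x` minimizes `Θ_{y'}`. For the quadratic cost, `Θ_{y'} - Θ_y` is affine with
linear part `y - y'`; it is minimal on `M` at `x`, and since smoothness makes the normal cone of `M`
at `x` a ray, `y' = y + s • n_M(x)` with `s ≥ 0` (`exists_eq_add_smul_outerNormal`).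

Everything rests on `s > 0`. If `s = 0`, then `Θ_y` is both maximal and minimal at `x`, hence
constant, and `y` is in contact with all of `M`. Optimality forbids this (`not_forall_add_eq_cost`).
Indeed, a point `z` in contact with another `y₁` would have `y₁ - y` as an outer normal direction,
but `y₁ - y` makes a non-acute angle with `u = n_N(y)`, while near the top of `M` in the direction
`u` normals are close to `u`. So the top is in contact with `y` alone. Raising `φ` there and
lowering `ψ` only near `y` stays admissible; the gain is fixed and the loss is arbitrarily small
because `ν` has no atoms.

Once `s > 0`, strict convexity of `N` does the rest: the line through `y` and `y'` meets `N` nowhere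
else, it enters at `y` and leaves at `y'`, which gives uniqueness and both signs. Finally `φ` is
squeezed at `x` between two smooth functions whose gradients differ by a normal vector, so it is
differentiable along `M`. -/

/-! ### Supporting half-spaces of bounded convex domains. -/

theorem exists_add_smul_mem_frontier {U : Set (Euc n)} (hU : IsOpen U)
    (hb : Bornology.IsBounded U) {p d : Euc n} (hp : p ∈ U) (hd : d ≠ 0) :
    ∃ t : ℝ, 0 < t ∧ p + t • d ∈ frontier U := by
  have hcont : Continuous fun t : ℝ => p + t • d := by fun_prop
  have hcl : IsClosed {t : ℝ | p + t • d ∈ closure U} := isClosed_closure.preimage hcont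
  have hbdd : Bornology.IsBounded {t : ℝ | p + t • d ∈ closure U} := by
    obtain ⟨R, hR⟩ := (hb.closure).subset_closedBall p
    refine (Metric.isBounded_closedBall (x := (0 : ℝ)) (r := R / ‖d‖)).subset fun t ht => ?_
    have h := hR ht
    rw [Metric.mem_closedBall, dist_eq_norm, add_sub_cancel_left, norm_smul] at h
    rw [mem_closedBall_zero_iff, le_div_iff₀ (norm_pos_iff.2 hd)]
    exact h
  obtain ⟨t, ht, hmax⟩ := (Metric.isCompact_of_isClosed_isBounded hcl hbdd).exists_isGreatest
    ⟨0, by simpa using subset_closure hp⟩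
  have hright : ∀ s : ℝ, p + s • d ∈ U → s < t := by
    intro s hs
    have hev : ∀ᶠ r in 𝓝[>] s, p + r • d ∈ U :=
      (hcont.continuousAt.eventually (hU.mem_nhds hs)).filter_mono nhdsWithin_le_nhds
    obtain ⟨r, hr, hsr⟩ := (hev.and self_mem_nhdsWithin).exists
    exact lt_of_lt_of_le hsr (hmax (subset_closure hr))
  refine ⟨t, hright 0 (by simpa using hp), ?_⟩
  rw [hU.frontier_eq]
  exact ⟨ht, fun h => lt_irrefl t (hright t h)⟩

/-- Moving from `p` in the direction `w` strictly increases the functional before the frontier is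
reached. -/
theorem inner_sub_neg_of_mem {U : Set (Euc n)} (hU : IsOpen U) (hb : Bornology.IsBounded U)
    {x w : Euc n} (hw : w ≠ 0) (h : ∀ z ∈ frontier U, inner ℝ w (z - x) ≤ 0) {p : Euc n}
    (hp : p ∈ U) : inner ℝ w (p - x) < 0 := by
  obtain ⟨t, ht, hmem⟩ := exists_add_smul_mem_frontier hU hb hp hw
  have h1 := h _ hmem
  rw [add_sub_right_comm, inner_add_right, inner_smul_right, real_inner_self_eq_norm_sq] at h1
  have h2 : 0 < ‖w‖ := norm_pos_iff.2 hw
  nlinarith [mul_pos ht (pow_pos h2 2)]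

theorem exists_unit_support {U : Set (Euc n)} (hU : IsOpen U) (hne : U.Nonempty)
    (hc : Convex ℝ U) {x : Euc n} (hx : x ∉ U) :
    ∃ w : Euc n, ‖w‖ = 1 ∧ ∀ z ∈ closure U, inner ℝ w (z - x) ≤ 0 := by
  obtain ⟨L, hL⟩ := geometric_hahn_banach_open_point hc hU hx
  set w := (InnerProductSpace.toDual ℝ (Euc n)).symm L with hw
  have hwL : ∀ z, inner ℝ w z = L z := fun z => InnerProductSpace.toDual_symm_apply
  have hw0 : w ≠ 0 := by
    intro h0
    obtain ⟨p, hp⟩ := hne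
    have := hL p hp
    rw [← hwL, ← hwL, h0] at this
    simp at this
  have hU' : ∀ z ∈ closure U, inner ℝ w (z - x) ≤ 0 := by
    intro z hz
    refine closure_minimal (t := {z | inner ℝ w (z - x) ≤ 0}) (fun p hp => ?_)
      (isClosed_le (by fun_prop) continuous_const) hz
    have := hL p hp
    rw [← hwL, ← hwL] at this
    simp only [mem_ofPred_eq, inner_sub_right]
    linarith
  refine ⟨‖w‖⁻¹ • w, norm_smul_inv_norm hw0, fun z hz => ?_⟩
  rw [real_inner_smul_left]
  exact mul_nonpos_of_nonneg_of_nonpos (by positivity) (hU' z hz)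

/-! ### Tangent spaces, normal cones and the outer normal. -/

/-- `L` is the differential of a local defining function: the implicit function theorem puts its
kernel in the tangent cone, and Lagrange multipliers treat functionals maximal at `x`. -/
theorem IsSmoothHypersurface.exists_linearization {M : Set (Euc n)} (hM : IsSmoothHypersurface M)
    {x : Euc n} (hx : x ∈ M) :
    ∃ L : Euc n →L[ℝ] ℝ, L ≠ 0 ∧ HasFDerivWithinAt L (0 : Euc n →L[ℝ] ℝ) M x ∧
      (∀ v, L v = 0 → v ∈ tangentConeAt ℝ M x) ∧
      ∀ K : Euc n →L[ℝ] ℝ, IsMaxOn K M x → ∃ c : ℝ, K = c • L := by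
  obtain ⟨W, ρ, hW, hxW, hρ, hd, hMW⟩ := hM x hx
  have hWx : W ∈ 𝓝 x := hW.mem_nhds hxW
  have hzero : ∀ z ∈ W, (z ∈ M ↔ ρ z = 0) := fun z hz => by
    have : z ∈ M ∩ W ↔ z ∈ {x ∈ W | ρ x = 0} := by rw [hMW]
    simpa [hz] using this
  have hρx : ρ x = 0 := (hzero x hxW).1 hx
  have hst : HasStrictFDerivAt ρ (fderiv ℝ ρ x) x :=
    (hρ.contDiffAt hWx).hasStrictFDerivAt (by simp)
  set L := fderiv ℝ ρ x with hL
  have hL0 : L ≠ 0 := hd x hxW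
  refine ⟨L, hL0, ?_, ?_, ?_⟩
  · have h1 : HasFDerivWithinAt (fun z => L z - ρ z) (L - L) M x :=
      (L.hasFDerivAt.sub hst.hasFDerivAt).hasFDerivWithinAt
    rw [sub_self] at h1
    refine h1.congr_of_eventuallyEq ?_ (by simp [hρx])
    filter_upwards [self_mem_nhdsWithin, nhdsWithin_le_nhds hWx] with z hz hzW
    simp [(hzero z hzW).1 hz]
  · intro v hv
    have hsurj : (L : Euc n →ₗ[ℝ] ℝ).range = ⊤ :=
      LinearMap.range_eq_top.2 (LinearMap.surjective (fun h => hL0 (by ext z; exact congr($h z))))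
    set γ := HasStrictFDerivAt.implicitFunction ρ L hst hsurj (ρ x) with hγ
    have hγ' : HasStrictFDerivAt γ (L : Euc n →ₗ[ℝ] ℝ).ker.subtypeL 0 :=
      hst.to_implicitFunction hsurj
    have hγ0 : γ 0 = x := hst.implicitFunction_apply_image hsurj
    have hev1 : ∀ᶠ p in 𝓝 (0 : (L : Euc n →ₗ[ℝ] ℝ).ker), ρ (γ p) = ρ x := by
      have h := hst.map_implicitFunction_eq hsurj
      have ht : Tendsto (fun p : (L : Euc n →ₗ[ℝ] ℝ).ker => (ρ x, p)) (𝓝 0) (𝓝 (ρ x, 0)) :=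
        (Continuous.prodMk_right (ρ x)).tendsto 0
      exact ht.eventually h
    have hev2 : ∀ᶠ p in 𝓝 (0 : (L : Euc n →ₗ[ℝ] ℝ).ker), γ p ∈ W :=
      hγ'.hasFDerivAt.continuousAt.eventually (by rw [hγ0]; exact hWx)
    have hS : {p | γ p ∈ M} ∈ 𝓝 (0 : (L : Euc n →ₗ[ℝ] ℝ).ker) := by
      filter_upwards [hev1, hev2] with p h1 h2
      exact (hzero _ h2).2 (h1.trans hρx)
    have hmap := (hγ'.hasFDerivAt.hasFDerivWithinAt (s := {p | γ p ∈ M})).mapsTo_tangent_cone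
    rw [tangentConeAt_of_mem_nhds hS, hγ0] at hmap
    have hv' := hmap (mem_univ (⟨v, hv⟩ : (L : Euc n →ₗ[ℝ] ℝ).ker))
    refine tangentConeAt_mono ?_ hv'
    rintro _ ⟨p, hp, rfl⟩
    exact hp
  · intro K hK
    have hloc : IsLocalMaxOn K {z | ρ z = ρ x} x := by
      have : ∀ᶠ z in 𝓝[{z | ρ z = ρ x}] x, K z ≤ K x := by
        filter_upwards [self_mem_nhdsWithin, nhdsWithin_le_nhds hWx] with z hz hzW
        exact hK ((hzero z hzW).2 (hz.trans hρx))
      exact this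
    obtain ⟨a, b, hab, h⟩ := IsLocalExtrOn.exists_multipliers_of_hasStrictFDerivAt_1d
      hloc.isExtr hst K.hasStrictFDerivAt
    have hb : b ≠ 0 := by
      rintro rfl
      have ha : a ≠ 0 := by rintro rfl; exact hab rfl
      rw [zero_smul, add_zero, smul_eq_zero] at h
      exact h.elim ha hL0
    refine ⟨-(b⁻¹ * a), ?_⟩
    ext z
    have hz := congr($h z)
    simp only [add_apply, smul_apply, smul_eq_mul, zero_apply] at hz ⊢
    field_simp
    linarith

theorem IsSmoothStrictlyConvexDomain.exists_normal {U : Set (Euc n)}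
    (hU : IsSmoothStrictlyConvexDomain U) {x : Euc n} (hx : x ∈ frontier U) :
    ∃ w : Euc n, ‖w‖ = 1 ∧ (∀ z ∈ closure U, inner ℝ w (z - x) ≤ 0) ∧
      tangentSpaceOf (frontier U) x = (Submodule.span ℝ {w})ᗮ ∧
      HasFDerivWithinAt (fun z => inner ℝ w z) (0 : Euc n →L[ℝ] ℝ) (frontier U) x ∧
      ∀ v : Euc n, (∀ z ∈ frontier U, inner ℝ v (z - x) ≤ 0) → ∃ t : ℝ, 0 ≤ t ∧ v = t • w := by
  have hfr : frontier U ⊆ closure U := frontier_subset_closure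
  obtain ⟨w, hw1, hw⟩ := exists_unit_support hU.isOpen hU.nonempty hU.convex
    (x := x) (by rw [hU.isOpen.frontier_eq] at hx; exact hx.2)
  have hw0 : w ≠ 0 := by rintro rfl; simp at hw1
  obtain ⟨L, hL0, hLd, hLt, hLm⟩ := hU.smooth_frontier.exists_linearization hx
  have hmult : ∀ v : Euc n, (∀ z ∈ frontier U, inner ℝ v (z - x) ≤ 0) →
      ∃ c : ℝ, innerSL ℝ v = c • L := by
    intro v hv
    refine hLm _ fun z hz => ?_
    have := hv z hz
    rw [inner_sub_right] at this
    simpa using this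
  obtain ⟨c, hc⟩ := hmult w fun z hz => hw z (hfr hz)
  have hc0 : c ≠ 0 := by
    rintro rfl
    have := congr($hc w)
    simp [hw0] at this
  have hLc : L = c⁻¹ • innerSL ℝ w := by rw [hc, smul_smul, inv_mul_cancel₀ hc0, one_smul]
  have hker : ∀ v, L v = 0 ↔ inner ℝ w v = 0 := by
    intro v
    rw [hLc]
    simp [hc0]
  refine ⟨w, hw1, hw, ?_, ?_, ?_⟩
  · apply le_antisymm
    · refine Submodule.span_le.2 fun v hv => ?_
      have h1 := HasFDerivWithinAt.unique_on L.hasFDerivAt.hasFDerivWithinAt hLd hv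
      exact Submodule.mem_orthogonal_singleton_iff_inner_right.2 ((hker v).1 h1)
    · intro v hv
      exact Submodule.subset_span
        (hLt v ((hker v).2 (Submodule.mem_orthogonal_singleton_iff_inner_right.1 hv)))
  · have h := hLd.const_smul c
    rw [smul_zero] at h
    refine h.congr_of_eventuallyEq (Eventually.of_forall fun z => ?_) ?_
    · exact congr($hc z)
    · exact congr($hc x)
  · intro v hv
    obtain ⟨b, hb⟩ := hmult v hv
    have hvw : v = (b * c⁻¹) • w := by
      refine ext_inner_right ℝ fun z => ?_
      have := congr($hb z)
      rw [hLc] at this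
      simpa [real_inner_smul_left, mul_assoc] using this
    refine ⟨b * c⁻¹, ?_, hvw⟩
    -- A negative multiple would make an interior point strictly negative for both `w` and `v`.
    by_contra! hneg
    obtain ⟨p, hp⟩ := hU.nonempty
    have h1 := inner_sub_neg_of_mem hU.isOpen hU.isBounded hw0 (fun z hz => hw z (hfr hz)) hp
    have hv0 : v ≠ 0 := by rw [hvw]; exact smul_ne_zero hneg.ne hw0
    have h2 := inner_sub_neg_of_mem hU.isOpen hU.isBounded hv0 hv hp
    rw [hvw, real_inner_smul_left] at h2
    nlinarith

/-- Identifies the normal defined by tangent spaces with the one defined by support, so that the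
choice in `outerNormal` is determined. -/
theorem IsSmoothStrictlyConvexDomain.isOuterUnitNormal_iff {U : Set (Euc n)}
    (hU : IsSmoothStrictlyConvexDomain U) {x w : Euc n} (hx : x ∈ frontier U) (hw1 : ‖w‖ = 1)
    (hw : ∀ z ∈ closure U, inner ℝ w (z - x) ≤ 0)
    (hT : tangentSpaceOf (frontier U) x = (Submodule.span ℝ {w})ᗮ)
    (hcone : ∀ v : Euc n, (∀ z ∈ frontier U, inner ℝ v (z - x) ≤ 0) → ∃ t : ℝ, 0 ≤ t ∧ v = t • w)
    (v : Euc n) : IsOuterUnitNormal U x v ↔ v = w := by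
  have hw0 : w ≠ 0 := by rintro rfl; simp at hw1
  constructor
  · rintro ⟨hv1, hvT, hout⟩
    rw [hT, Submodule.orthogonal_orthogonal, Submodule.mem_span_singleton] at hvT
    obtain ⟨a, rfl⟩ := hvT
    rw [norm_smul, hw1, mul_one, Real.norm_eq_abs] at hv1
    rcases eq_or_eq_neg_of_abs_eq hv1 with rfl | rfl
    · simp
    exfalso
    -- If `-w` pointed outwards, a short segment from `x` along `-w` could be separated from `U`.
    -- The separating functional supports `U` at `x`, so it is a nonnegative multiple of `w`, yet it
    -- would have to not decrease along `-w`.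
    obtain ⟨ε, hε, hsub⟩ := mem_nhdsGT_iff_exists_Ioo_subset.1 hout
    have hε : (0 : ℝ) < ε := hε
    set S : Set (Euc n) := (fun t : ℝ => x + t • ((-1 : ℝ) • w)) '' Ioo 0 ε with hS
    have hSc : Convex ℝ S := by
      have : S = (AffineMap.lineMap (k := ℝ) x (x + (-1 : ℝ) • w)) '' Ioo 0 ε := by
        rw [hS]
        refine image_congr fun t _ => ?_
        simp [AffineMap.lineMap_apply, add_comm]
      rw [this]
      exact (convex_Ioo 0 ε).affine_image _
    have hdisj : Disjoint U S := by
      rw [Set.disjoint_right]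
      rintro _ ⟨t, ht, rfl⟩ hmem
      exact hsub ht (subset_closure hmem)
    obtain ⟨K, u, hK1, hK2⟩ := geometric_hahn_banach_open hU.convex hU.isOpen hSc hdisj
    set q := (InnerProductSpace.toDual ℝ (Euc n)).symm K with hq
    have hqK : ∀ z, inner ℝ q z = K z := fun z => InnerProductSpace.toDual_symm_apply
    have hcl : ∀ z ∈ closure U, K z ≤ u := fun z hz =>
      closure_minimal (t := {z | K z ≤ u}) (fun p hp => (hK1 p hp).le)
        (isClosed_le K.continuous continuous_const) hz
    have hKt : ∀ t ∈ Ioo 0 ε, u ≤ K x - t * K w := by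
      intro t ht
      have := hK2 _ ⟨t, ht, rfl⟩
      simpa [sub_eq_add_neg] using this
    have hux : u ≤ K x := by
      have hlim : Tendsto (fun t : ℝ => K x - t * K w) (𝓝[>] 0) (𝓝 (K x - 0 * K w)) := by
        have : Continuous fun t : ℝ => K x - t * K w := by fun_prop
        exact (this.tendsto 0).mono_left nhdsWithin_le_nhds
      rw [zero_mul, sub_zero] at hlim
      refine ge_of_tendsto hlim ?_
      filter_upwards [Ioo_mem_nhdsGT hε] with t ht using hKt t ht
    obtain ⟨t, ht, hqt⟩ := hcone q fun z hz => by
      rw [inner_sub_right, hqK, hqK]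
      linarith [hcl z (frontier_subset_closure hz)]
    have hKw : K w = t := by
      rw [← hqK, hqt, real_inner_smul_left, real_inner_self_eq_norm_sq, hw1]; ring
    obtain ⟨p, hp⟩ := hU.nonempty
    have hKp := hK1 p hp
    have hpx := hw p (subset_closure hp)
    have h1 := hKt (ε / 2) ⟨by linarith, by linarith⟩
    have hKp' : K p = K x + t * inner ℝ w (p - x) := by
      rw [← real_inner_smul_left, ← hqt, hqK, map_sub]; ring
    have hxu := hcl x (frontier_subset_closure hx)
    rcases ht.eq_or_lt with h0 | h0
    · rw [← h0] at hKp'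
      linarith
    · rw [hKw] at h1
      nlinarith
  · rintro rfl
    refine ⟨hw1, ?_, ?_⟩
    · rw [hT, Submodule.orthogonal_orthogonal]
      exact Submodule.mem_span_singleton_self _
    · filter_upwards [self_mem_nhdsWithin] with t ht hmem
      have := hw _ hmem
      rw [add_sub_cancel_left, inner_smul_right, real_inner_self_eq_norm_sq, hw1] at this
      have ht : (0 : ℝ) < t := ht
      nlinarith

theorem IsSmoothStrictlyConvexDomain.outerNormal_spec {U : Set (Euc n)}
    (hU : IsSmoothStrictlyConvexDomain U) {x : Euc n} (hx : x ∈ frontier U) :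
    ‖outerNormal U x‖ = 1 ∧ (∀ z ∈ closure U, inner ℝ (outerNormal U x) (z - x) ≤ 0) ∧
      tangentSpaceOf (frontier U) x = (Submodule.span ℝ {outerNormal U x})ᗮ ∧
      HasFDerivWithinAt (fun z => inner ℝ (outerNormal U x) z) (0 : Euc n →L[ℝ] ℝ)
        (frontier U) x ∧
      ∀ v : Euc n, (∀ z ∈ frontier U, inner ℝ v (z - x) ≤ 0) →
        ∃ t : ℝ, 0 ≤ t ∧ v = t • outerNormal U x := by
  obtain ⟨w, h1, h2, h3, h4, h5⟩ := hU.exists_normal hx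
  have hiff := hU.isOuterUnitNormal_iff hx h1 h2 h3 h5
  have hw : outerNormal U x = w :=
    (hiff _).1 (Classical.epsilon_spec (p := IsOuterUnitNormal U x) ⟨w, (hiff w).2 rfl⟩)
  rw [hw]
  exact ⟨h1, h2, h3, h4, h5⟩

/-! ### Strict convexity and lines. -/

/-- The midpoint of `x` and `z` is interior, where the support inequality is strict. -/
theorem IsSmoothStrictlyConvexDomain.inner_outerNormal_neg {U : Set (Euc n)}
    (hU : IsSmoothStrictlyConvexDomain U) {x z : Euc n} (hx : x ∈ frontier U)
    (hz : z ∈ closure U) (hzx : z ≠ x) : inner ℝ (outerNormal U x) (z - x) < 0 := by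
  obtain ⟨h1, h2, -⟩ := hU.outerNormal_spec hx
  have hw0 : outerNormal U x ≠ 0 := by intro h; rw [h] at h1; simp at h1
  have hm := hU.strictConvex_closure (frontier_subset_closure hx) hz hzx.symm
    (a := 1 / 2) (b := 1 / 2) (by norm_num) (by norm_num) (by norm_num)
  have h := inner_sub_neg_of_mem isOpen_interior (hU.isBounded.closure.subset interior_subset)
    hw0 (x := x) (fun y hy => h2 y (frontier_subset_closure
      (frontier_closure_subset (frontier_interior_subset hy)))) hm
  have he : (1 / 2 : ℝ) • x + (1 / 2 : ℝ) • z - x = (1 / 2 : ℝ) • (z - x) := by module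
  rw [he, inner_smul_right] at h
  linarith

theorem IsSmoothStrictlyConvexDomain.notMem_frontier_of_between {U : Set (Euc n)}
    (hU : IsSmoothStrictlyConvexDomain U) {q d : Euc n} {a b : ℝ} (ha : a < 0) (hb : 0 < b)
    (hd : d ≠ 0) (hqa : q + a • d ∈ closure U) (hqb : q + b • d ∈ closure U) :
    q ∉ frontier U := by
  intro hq
  have h1 := hU.inner_outerNormal_neg hq hqa (by simp [ha.ne, hd])
  have h2 := hU.inner_outerNormal_neg hq hqb (by simp [hb.ne', hd])
  rw [add_sub_cancel_left, inner_smul_right] at h1 h2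
  have h3 : inner ℝ (outerNormal U q) d < 0 := by
    by_contra! h
    nlinarith [mul_nonneg hb.le h]
  nlinarith [mul_pos_of_neg_of_neg ha h3]

theorem IsSmoothStrictlyConvexDomain.eq_zero_or_eq_of_mem_line {U : Set (Euc n)}
    (hU : IsSmoothStrictlyConvexDomain U) {p d : Euc n} {s r : ℝ} (hd : d ≠ 0) (hs : 0 < s)
    (hp : p ∈ frontier U) (hps : p + s • d ∈ frontier U) (hpr : p + r • d ∈ frontier U) :
    r = 0 ∨ r = s := by
  by_contra! hne
  have hcl := fun {z} (hz : z ∈ frontier U) => frontier_subset_closure hz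
  rcases lt_or_gt_of_ne hne.1 with h0 | h0
  · exact hU.notMem_frontier_of_between h0 hs hd (hcl hpr) (hcl hps) hp
  · rcases lt_or_gt_of_ne hne.2 with h1 | h1
    · refine hU.notMem_frontier_of_between (a := -r) (b := s - r) (by linarith) (by linarith) hd
        ?_ ?_ hpr
      · convert hcl hp using 1; module
      · convert hcl hps using 1; module
    · refine hU.notMem_frontier_of_between (a := -s) (b := r - s) (by linarith) (by linarith) hd
        ?_ ?_ hps
      · convert hcl hp using 1; module
      · convert hcl hpr using 1; module

theorem IsSmoothStrictlyConvexDomain.isCompact_frontier {U : Set (Euc n)}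
    (hU : IsSmoothStrictlyConvexDomain U) : IsCompact (frontier U) :=
  Metric.isCompact_of_isClosed_isBounded isClosed_frontier
    (hU.isBounded.closure.subset frontier_subset_closure)

theorem IsSmoothStrictlyConvexDomain.frontier_nonempty {U : Set (Euc n)}
    (hU : IsSmoothStrictlyConvexDomain U) (hn : 1 ≤ n) : (frontier U).Nonempty := by
  have : Nonempty (Fin n) := ⟨⟨0, hn⟩⟩
  obtain ⟨d, hd⟩ := exists_ne (0 : Euc n)
  obtain ⟨p, hp⟩ := hU.nonempty
  obtain ⟨t, -, ht⟩ := exists_add_smul_mem_frontier hU.isOpen hU.isBounded hp hd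
  exact ⟨_, ht⟩

/-! ### Tangential gradients and the quadratic cost. -/

theorem IsTangentialGradient.unique {M : Set (Euc n)} {φ : Euc n → ℝ} {x v w : Euc n}
    (hv : IsTangentialGradient M φ x v) (hw : IsTangentialGradient M φ x w) : v = w := by
  have heq := HasFDerivWithinAt.unique_on hv.2.hasFDerivWithinAt hw.2.hasFDerivWithinAt
  have horth : v - w ∈ (tangentSpaceOf M x)ᗮ := by
    have hle : tangentSpaceOf M x ≤ (Submodule.span ℝ {v - w})ᗮ := by
      refine Submodule.span_le.2 fun d hd => ?_
      have := heq hd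
      simp only [InnerProductSpace.toDual_apply_apply] at this
      refine Submodule.mem_orthogonal_singleton_iff_inner_right.2 ?_
      rw [inner_sub_left, this, sub_self]
    exact (Submodule.mem_orthogonal _ _).2 fun d hd => by
      rw [real_inner_comm]
      exact Submodule.mem_orthogonal_singleton_iff_inner_right.1 (hle hd)
  have h0 := (Submodule.mem_orthogonal _ _).1 horth _ (Submodule.sub_mem _ hv.1 hw.1)
  exact sub_eq_zero.1 (inner_self_eq_zero.1 h0)

theorem IsTangentialGradient.tangentialGradient_eq {M : Set (Euc n)} {φ : Euc n → ℝ}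
    {x v : Euc n} (hv : IsTangentialGradient M φ x v) : tangentialGradient M φ x = v :=
  IsTangentialGradient.unique (Classical.epsilon_spec (p := IsTangentialGradient M φ x) ⟨v, hv⟩) hv

theorem cost_sub_cost (x y y' : Euc n) :
    cost x y - cost x y' = inner ℝ (y' - y) x + (‖y‖ ^ 2 - ‖y'‖ ^ 2) / 2 := by
  unfold cost
  rw [norm_sub_sq_real, norm_sub_sq_real, inner_sub_left, real_inner_comm x y,
    real_inner_comm x y']
  ring

theorem cost_eq_add (z x y : Euc n) :
    cost z y = cost x y + inner ℝ (x - y) (z - x) + 1 / 2 * ‖z - x‖ ^ 2 := by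
  unfold cost
  have h : z - y = (z - x) + (x - y) := by abel
  rw [h, norm_add_sq_real, real_inner_comm]
  ring

theorem continuous_cost : Continuous fun p : Euc n × Euc n => cost p.1 p.2 := by
  unfold cost
  fun_prop

/-- A function on the boundary that is squeezed at `x` between two translated costs whose poles
differ by a normal vector has a gradient at `x` along the boundary. -/
theorem IsSmoothStrictlyConvexDomain.isTangentialGradient_of_squeeze {U : Set (Euc n)}
    (hU : IsSmoothStrictlyConvexDomain U) {φ : Euc n → ℝ} {x y : Euc n} {s : ℝ}
    (hx : x ∈ frontier U)
    (hlow : ∀ z ∈ frontier U, φ x + (cost z y - cost x y) ≤ φ z)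
    (hup : ∀ z ∈ frontier U, φ z ≤ φ x + (cost z (y + s • outerNormal U x) -
      cost x (y + s • outerNormal U x))) :
    IsTangentialGradient (frontier U) φ x
      ((x - y) - inner ℝ (outerNormal U x) (x - y) • outerNormal U x) := by
  obtain ⟨h1, -, hT, hd, -⟩ := hU.outerNormal_spec hx
  set w := outerNormal U x with hw
  have hlin : (fun z => inner ℝ w (z - x)) =o[𝓝[frontier U] x] fun z => z - x := by
    have := hd.isLittleO
    simpa [inner_sub_right] using this
  have hsq : (fun z : Euc n => ‖z - x‖ ^ 2) =o[𝓝[frontier U] x] fun z => z - x := by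
    have h := (Asymptotics.isLittleO_norm_pow_id (E' := Euc n) one_lt_two).comp_tendsto
      (tendsto_sub_nhds_zero_iff.2 (tendsto_id (α := Euc n) (x := 𝓝 x)))
    exact h.mono nhdsWithin_le_nhds
  refine ⟨?_, ?_⟩
  · rw [hT, Submodule.mem_orthogonal_singleton_iff_inner_right, inner_sub_right, inner_smul_right,
      real_inner_self_eq_norm_sq, h1]
    ring
  · rw [hasGradientWithinAt_iff_hasFDerivWithinAt]
    refine HasFDerivWithinAt.of_isLittleO ?_
    -- The remainder lies between `1/2 * ‖z - x‖ ^ 2` and that quantity minus `s * ⟪w, z - x⟫`; both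
    -- terms are `o(‖z - x‖)` on the boundary. The normal part of `x - y` can then be removed for
    -- the same reason.
    have hbig : (fun z => φ z - φ x - inner ℝ (x - y) (z - x)) =O[𝓝[frontier U] x]
        fun z => |1 / 2 * ‖z - x‖ ^ 2| + |s * inner ℝ w (z - x)| := by
      refine Asymptotics.IsBigO.of_bound 1 ?_
      filter_upwards [self_mem_nhdsWithin] with z hz
      have hl := hlow z hz
      have hu := hup z hz
      rw [cost_eq_add z x] at hl hu
      have he : x - (y + s • w) = (x - y) - s • w := by abel
      rw [he, inner_sub_left, real_inner_smul_left] at hu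
      rw [one_mul, Real.norm_eq_abs, Real.norm_eq_abs, abs_of_nonneg (a := |_| + |_|) (by positivity),
        abs_le]
      constructor
      · have : 0 ≤ 1 / 2 * ‖z - x‖ ^ 2 := by positivity
        linarith [abs_nonneg (s * inner ℝ w (z - x)), abs_nonneg (1 / 2 * ‖z - x‖ ^ 2)]
      · linarith [neg_abs_le (s * inner ℝ w (z - x)), le_abs_self (1 / 2 * ‖z - x‖ ^ 2)]
    have ho : (fun z => |1 / 2 * ‖z - x‖ ^ 2| + |s * inner ℝ w (z - x)|) =o[𝓝[frontier U] x]
        fun z => z - x :=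
      ((hsq.const_mul_left (1 / 2)).abs_left).add ((hlin.const_mul_left s).abs_left)
    have h := (hbig.trans_isLittleO ho).add
      (hlin.const_mul_left (inner ℝ w (x - y)))
    refine h.congr_left fun z => ?_
    simp only [InnerProductSpace.toDual_apply_apply, inner_sub_left, real_inner_smul_left]
    ring

/-! ### Surface measure: caps have mass, points do not. -/

theorem euclideanHausdorffMeasure_image_le {X Y : Type*} [EMetricSpace X] [MeasurableSpace X]
    [BorelSpace X] [EMetricSpace Y] [MeasurableSpace Y] [BorelSpace Y] {F : X → Y}
    (hF : LipschitzWith 1 F) (d : ℕ) (s : Set X) :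
    (μHE[d] : Measure Y) (F '' s) ≤ (μHE[d] : Measure X) s := by
  rw [Measure.euclideanHausdorffMeasure_def, Measure.euclideanHausdorffMeasure_def,
    Measure.smul_apply, Measure.smul_apply]
  have h := hF.hausdorffMeasure_image_le (d := (d : ℝ)) (Nat.cast_nonneg d) s
  rw [ENNReal.coe_one, ENNReal.one_rpow, one_mul] at h
  gcongr

/-- Orthogonal projection along `u` does not increase measure, and the shadow of the boundary cap
contains that of the solid cap, a nonempty open subset of the hyperplane. -/
theorem euclideanHausdorffMeasure_cap_pos (hn : 1 ≤ n) {U : Set (Euc n)} (hU : IsOpen U)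
    (hb : Bornology.IsBounded U) {u : Euc n} (hu : u ≠ 0) {a : ℝ} {p : Euc n} (hp : p ∈ U)
    (hpa : a < inner ℝ u p) :
    0 < (μHE[n - 1] : Measure (Euc n)) (frontier U ∩ {z | a < inner ℝ u z}) := by
  have hfact : Fact (Module.finrank ℝ (Euc n) = (n - 1) + 1) := ⟨by simp; omega⟩
  have hrank : Module.finrank ℝ (Submodule.span ℝ {u})ᗮ = n - 1 :=
    Submodule.finrank_orthogonal_span_singleton hu
  set H := (Submodule.span ℝ {u})ᗮ with hH
  set π : Euc n →L[ℝ] H := H.orthogonalProjectionOnto with hπ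
  have hπu : π u = 0 := by
    rw [hπ, Submodule.orthogonalProjectionOnto_eq_zero_iff, hH, Submodule.orthogonal_orthogonal]
    exact Submodule.mem_span_singleton_self u
  have hlip : LipschitzWith 1 π := by
    refine LipschitzWith.of_dist_le_mul fun y z => ?_
    rw [NNReal.coe_one, one_mul, dist_eq_norm, dist_eq_norm, ← map_sub]
    exact H.norm_orthogonalProjectionOnto_apply_le _
  have hsurj : Function.Surjective π := fun y =>
    ⟨y, Submodule.orthogonalProjectionOnto_mem_subspace_eq_self y⟩
  have hopen : IsOpen (π '' (U ∩ {z | a < inner ℝ u z})) :=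
    π.isOpenMap hsurj _ (hU.inter (isOpen_lt continuous_const (by fun_prop)))
  have hsub : π '' (U ∩ {z | a < inner ℝ u z}) ⊆ π '' (frontier U ∩ {z | a < inner ℝ u z}) := by
    rintro _ ⟨q, ⟨hqU, hqa⟩, rfl⟩
    obtain ⟨t, ht, hmem⟩ := exists_add_smul_mem_frontier hU hb hqU hu
    refine ⟨q + t • u, ⟨hmem, ?_⟩, by rw [map_add, map_smul, hπu, smul_zero, add_zero]⟩
    have hqa : a < inner ℝ u q := hqa
    change a < inner ℝ u (q + t • u)
    rw [inner_add_right, inner_smul_right]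
    nlinarith [mul_nonneg ht.le (real_inner_self_nonneg (x := u))]
  calc 0 < (μHE[n - 1] : Measure H) (π '' (U ∩ {z | a < inner ℝ u z})) := by
        rw [← hrank]
        exact hopen.measure_pos _ ⟨π p, p, ⟨hp, hpa⟩, rfl⟩
    _ ≤ (μHE[n - 1] : Measure H) (π '' (frontier U ∩ {z | a < inner ℝ u z})) := measure_mono hsub
    _ ≤ _ := euclideanHausdorffMeasure_image_le hlip _ _

theorem densityMeasure_singleton (hn : 2 ≤ n) (N : Set (Euc n)) (g : Euc n → ℝ) (y : Euc n) :
    densityMeasure N g {y} = 0 := by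
  refine withDensity_absolutelyContinuous _ _ (Measure.restrict_le_self.absolutelyContinuous ?_)
  have : NullSingletonClass (μH[((n - 1 : ℕ) : ℝ)] : Measure (Euc n)) :=
    Measure.nullSingletonClass_hausdorff _ (by exact_mod_cast (by omega : 0 < n - 1))
  rw [Measure.euclideanHausdorffMeasure_def, Measure.smul_apply, measure_singleton, smul_zero]

theorem densityMeasure_pos {M S : Set (Euc n)} {f : Euc n → ℝ}
    (hf : ContinuousOn f M) (hf_pos : ∀ x ∈ M, 0 < f x) (hS : MeasurableSet S) (hSM : S ⊆ M)
    (h : 0 < (μHE[n - 1] : Measure (Euc n)) S) : 0 < densityMeasure M f S := by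
  rw [pos_iff_ne_zero]
  intro h0
  rw [densityMeasure, withDensity_apply _ hS, Measure.restrict_restrict hS,
    inter_eq_self_of_subset_left hSM, lintegral_eq_zero_iff'
      ((hf.mono hSM).aemeasurable hS).ennreal_ofReal] at h0
  have hfalse : ∀ᵐ x ∂(μHE[n - 1] : Measure (Euc n)).restrict S, False := by
    filter_upwards [h0, ae_restrict_mem hS] with x hx hxS
    exact absurd (ENNReal.ofReal_eq_zero.1 hx) (not_le.2 (hf_pos x (hSM hxS)))
  rw [eventually_false_iff_eq_bot, ae_eq_bot, Measure.restrict_eq_zero] at hfalse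
  exact h.ne' hfalse

theorem tendsto_setIntegral_spike {ν : Measure (Euc n)} [IsFiniteMeasure ν] {N : Set (Euc n)}
    {y₀ : Euc n} (hy₀ : ν {y₀} = 0) {c : ℝ} (hc : 0 ≤ c) :
    Tendsto (fun k : ℕ => ∫ y in N, max 0 (c - k * ‖y - y₀‖) ∂ν) atTop (𝓝 0) := by
  have h := tendsto_integral_of_dominated_convergence (μ := ν.restrict N)
    (F := fun (k : ℕ) y => max 0 (c - k * ‖y - y₀‖)) (f := fun _ => 0) (fun _ => c)
    (fun k => by
      have : Continuous fun y : Euc n => max 0 (c - k * ‖y - y₀‖) := by fun_prop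
      exact this.aestronglyMeasurable)
    (integrable_const c)
    (fun k => Eventually.of_forall fun y => by
      rw [Real.norm_of_nonneg (le_max_left _ _)]
      have : 0 ≤ (k : ℝ) * ‖y - y₀‖ := by positivity
      exact max_le hc (by linarith)) ?_
  · simpa using h
  · have hne : ∀ᵐ y ∂ν, y ≠ y₀ := by
      rw [ae_iff]
      simpa using hy₀
    filter_upwards [ae_restrict_of_ae hne] with y hy
    have hpos : 0 < ‖y - y₀‖ := norm_pos_iff.2 (sub_ne_zero.2 hy)
    refine tendsto_const_nhds.congr' ?_
    obtain ⟨K, hK⟩ := exists_nat_ge (c / ‖y - y₀‖)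
    filter_upwards [eventually_ge_atTop K] with k hk
    have hk' : c / ‖y - y₀‖ ≤ k := hK.trans (by exact_mod_cast hk)
    rw [div_le_iff₀ hpos] at hk'
    rw [max_eq_left (by linarith)]

/-- Near the top of a smooth strictly convex body in the direction `u`, no outer normal direction
makes a non-acute angle with `u`. -/
theorem IsSmoothStrictlyConvexDomain.exists_cap {U : Set (Euc n)}
    (hU : IsSmoothStrictlyConvexDomain U) (hn : 1 ≤ n) {u : Euc n} (hu : ‖u‖ = 1) :
    ∃ a : ℝ, ∃ x₁ ∈ frontier U, a < inner ℝ u x₁ ∧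
      (∀ z ∈ frontier U, inner ℝ u z ≤ inner ℝ u x₁) ∧
      ∀ z ∈ frontier U, a < inner ℝ u z → ∀ w : Euc n, w ≠ 0 → inner ℝ w u ≤ 0 →
        ¬ ∀ z' ∈ frontier U, inner ℝ w (z' - z) ≤ 0 := by
  obtain ⟨x₁, hx₁, hmax⟩ := hU.isCompact_frontier.exists_isMaxOn (hU.frontier_nonempty hn)
    (f := fun z => inner ℝ u z) (by fun_prop)
  set h := inner ℝ u x₁ with hh
  -- The bad pairs of a point and a unit normal form a compact set, so their heights do too. The top
  -- height `h` is not among them, since there the only unit normal is `u`; hence neither is an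
  -- interval below `h`.
  set Z : Set (Euc n × Euc n) := (frontier U ×ˢ Metric.sphere 0 1) ∩
    ({p | inner ℝ p.2 u ≤ 0} ∩ {p | ∀ z' ∈ frontier U, inner ℝ p.2 (z' - p.1) ≤ 0}) with hZ
  have hZc : IsCompact Z := by
    refine (hU.isCompact_frontier.prod (isCompact_sphere 0 1)).inter_right ?_
    refine (isClosed_le (by fun_prop) continuous_const).inter ?_
    have : {p : Euc n × Euc n | ∀ z' ∈ frontier U, inner ℝ p.2 (z' - p.1) ≤ 0} =
        ⋂ z' ∈ frontier U, {p : Euc n × Euc n | inner ℝ p.2 (z' - p.1) ≤ 0} := by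
      ext p; simp
    rw [this]
    exact isClosed_biInter fun z' _ => isClosed_le (by fun_prop) continuous_const
  have hI : IsCompact ((fun p : Euc n × Euc n => inner ℝ u p.1) '' Z) :=
    hZc.image (by fun_prop)
  have hnot : h ∉ (fun p : Euc n × Euc n => inner ℝ u p.1) '' Z := by
    rintro ⟨⟨z, w⟩, ⟨⟨hz, hw⟩, hwu, hsupp⟩, hzh⟩
    replace hz : z ∈ frontier U := hz
    replace hwu : inner ℝ w u ≤ 0 := hwu
    replace hsupp : ∀ z' ∈ frontier U, inner ℝ w (z' - z) ≤ 0 := hsupp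
    replace hzh : inner ℝ u z = h := hzh
    replace hw : ‖w‖ = 1 := mem_sphere_zero_iff_norm.1 hw
    obtain ⟨hn1, -, -, -, hcone⟩ := hU.outerNormal_spec hz
    obtain ⟨t, ht, rfl⟩ := hcone w hsupp
    obtain ⟨s, hs, rfl⟩ := hcone u fun z' hz' => by
      rw [inner_sub_right, hzh]
      linarith [show inner ℝ u z' ≤ h from hmax hz']
    rw [norm_smul, hn1, mul_one, Real.norm_of_nonneg ht] at hw
    rw [norm_smul, hn1, mul_one, Real.norm_of_nonneg hs] at hu
    rw [hw, hu, one_smul, real_inner_self_eq_norm_sq, hn1] at hwu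
    norm_num at hwu
  obtain ⟨a, ha, hsub⟩ := exists_Ioc_subset_of_mem_nhds
    (hI.isClosed.isOpen_compl.mem_nhds hnot) ⟨h - 1, by linarith⟩
  refine ⟨a, x₁, hx₁, ha, fun z hz => hmax hz, fun z hz haz w hw0 hwu hsupp => ?_⟩
  refine hsub (show inner ℝ u z ∈ Ioc a h from ⟨haz, hmax hz⟩)
    ⟨(z, ‖w‖⁻¹ • w), ⟨⟨hz, ?_⟩, ?_, ?_⟩, rfl⟩
  · rw [mem_sphere_zero_iff_norm]
    exact norm_smul_inv_norm hw0
  · change inner ℝ (‖w‖⁻¹ • w) u ≤ 0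
    rw [real_inner_smul_left]
    exact mul_nonpos_of_nonneg_of_nonpos (by positivity) hwu
  · intro z' hz'
    change inner ℝ (‖w‖⁻¹ • w) (z' - z) ≤ 0
    rw [real_inner_smul_left]
    exact mul_nonpos_of_nonneg_of_nonpos (by positivity) (hsupp z' hz')

/-- For an optimal pair no point of the target is in contact with the whole source: otherwise
moving mass near the top of the source in the direction of the outer normal at that point would
increase the dual functional. -/
theorem IsConjugateOptimalPair.not_forall_add_eq_cost (hn : 2 ≤ n) {U V : Set (Euc n)}
    (hU : IsSmoothStrictlyConvexDomain U) (hV : IsSmoothStrictlyConvexDomain V)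
    {f g : Euc n → ℝ} (hf : ContinuousOn f (frontier U)) (hf_pos : ∀ x ∈ frontier U, 0 < f x)
    [IsFiniteMeasure (densityMeasure (frontier U) f)]
    [IsFiniteMeasure (densityMeasure (frontier V) g)] {φ ψ : Euc n → ℝ}
    (h : IsConjugateOptimalPair (frontier U) (frontier V) (densityMeasure (frontier U) f)
      (densityMeasure (frontier V) g) φ ψ) {y₀ : Euc n} (hy₀ : y₀ ∈ frontier V) :
    ¬ ∀ x ∈ frontier U, φ x + ψ y₀ = cost x y₀ := by
  intro hc
  set μ := densityMeasure (frontier U) f with hμ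
  set ν := densityMeasure (frontier V) g with hν
  obtain ⟨hφ, hψ, hadm⟩ := h.admissible
  have hMc := hU.isCompact_frontier
  have hNc := hV.isCompact_frontier
  obtain ⟨hu1, hu, -⟩ := hV.outerNormal_spec hy₀
  set u := outerNormal V y₀ with hudef
  have hu0 : u ≠ 0 := by intro h0; rw [h0] at hu1; simp at hu1
  obtain ⟨a, x₁, hx₁, ha, hmax, hcap⟩ := hU.exists_cap (by omega) hu1
  obtain ⟨b, hab, hb⟩ := exists_between ha
  set C := inner ℝ u x₁ - b with hC
  have hCpos : 0 < C := sub_pos.2 hb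
  set η : Euc n → ℝ := fun z => max 0 (inner ℝ u z - b) with hη
  have hηc : Continuous η := by fun_prop
  have hη0 : ∀ z, 0 ≤ η z := fun z => le_max_left _ _
  have hηC : ∀ z ∈ frontier U, η z ≤ C := fun z hz =>
    max_le hCpos.le (sub_le_sub_right (hmax z hz) b)
  have hηint : 0 < ∫ z in frontier U, η z ∂μ := by
    rw [setIntegral_pos_iff_support_of_nonneg_ae (Eventually.of_forall hη0)
      (hηc.continuousOn.integrableOn_compact hMc)]
    obtain ⟨p, hp1, hp2⟩ : (U ∩ {z | b < inner ℝ u z}).Nonempty :=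
      (closure_inter_open_nonempty_iff (isOpen_lt continuous_const (by fun_prop))).1
        ⟨x₁, frontier_subset_closure hx₁, hb⟩
    have hcapm : MeasurableSet (frontier U ∩ {z | b < inner ℝ u z}) :=
      isClosed_frontier.measurableSet.inter
        (isOpen_lt continuous_const (by fun_prop)).measurableSet
    refine (densityMeasure_pos hf hf_pos hcapm inter_subset_left
      (euclideanHausdorffMeasure_cap_pos (by omega) hU.isOpen hU.isBounded hu0 hp1 hp2)).trans_le
      (measure_mono ?_)
    rintro z ⟨hzM, hzb⟩
    have hzb : b < inner ℝ u z := hzb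
    refine ⟨?_, hzM⟩
    rw [Function.mem_support, hη]
    exact (lt_max_of_lt_right (sub_pos.2 hzb)).ne'
  -- The spike has height `2 * C`, so that it still exceeds `C ≥ sup η` wherever `k * ‖y - y₀‖ < C`.
  -- The remaining `y` are handled by the positive gap on `K`.
  obtain ⟨k, hk⟩ := ((tendsto_setIntegral_spike (N := frontier V)
    (densityMeasure_singleton hn (frontier V) g y₀) (c := 2 * C) (by positivity)).eventually
      (gt_mem_nhds hηint)).exists
  set χ : Euc n → ℝ := fun y => max 0 (2 * C - k * ‖y - y₀‖) with hχ
  have hχc : Continuous χ := by fun_prop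
  have hχ0 : ∀ y, 0 ≤ χ y := fun y => le_max_left _ _
  set K : Set (Euc n × Euc n) := (frontier U ×ˢ frontier V) ∩
    ({p | b ≤ inner ℝ u p.1} ∩ {p | C ≤ k * ‖p.2 - y₀‖}) with hK
  have hKc : IsCompact K := (hMc.prod hNc).inter_right
    ((isClosed_le continuous_const (by fun_prop)).inter
      (isClosed_le continuous_const (by fun_prop)))
  have hGc : ContinuousOn (fun p : Euc n × Euc n => cost p.1 p.2 - φ p.1 - ψ p.2) K :=
    (continuous_cost.continuousOn.sub
      (hφ.comp continuousOn_fst fun p hp => hp.1.1)).sub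
      (hψ.comp continuousOn_snd fun p hp => hp.1.2)
  have hGpos : ∀ p ∈ K, 0 < cost p.1 p.2 - φ p.1 - ψ p.2 := by
    rintro ⟨z, y⟩ ⟨⟨hz, hy⟩, hzb, hyC⟩
    replace hz : z ∈ frontier U := hz
    replace hy : y ∈ frontier V := hy
    replace hzb : b ≤ inner ℝ u z := hzb
    replace hyC : C ≤ k * ‖y - y₀‖ := hyC
    change 0 < cost z y - φ z - ψ y
    have hyy : y - y₀ ≠ 0 := by
      intro h0
      rw [h0] at hyC
      simp at hyC
      linarith
    by_contra! hle
    refine hcap z hz (hab.trans_le hzb) (y - y₀) hyy ?_ fun z' hz' => ?_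
    · rw [real_inner_comm]
      exact hu y (frontier_subset_closure hy)
    · have h1 := hadm z' hz' y hy
      have h2 := hc z' hz'
      have h3 := hc z hz
      have h4 := cost_sub_cost z' y₀ y
      have h5 := cost_sub_cost z y₀ y
      rw [inner_sub_right]
      linarith
  obtain ⟨δ, hδ, hδK⟩ := hKc.exists_forall_le' hGc hGpos
  set ε := δ / C with hε
  have hεpos : 0 < ε := div_pos hδ hCpos
  have hεC : ε * C = δ := div_mul_cancel₀ δ hCpos.ne'
  have hadm' : IsAdmissible (frontier U) (frontier V) (fun z => φ z + ε * η z)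
      (fun y => ψ y - ε * χ y) := by
    refine ⟨hφ.add (hηc.const_mul ε).continuousOn, hψ.sub (hχc.const_mul ε).continuousOn,
      fun z hz y hy => ?_⟩
    have h0 := hadm z hz y hy
    have h1 := mul_nonneg hεpos.le (hχ0 y)
    by_cases hzb : b ≤ inner ℝ u z
    · by_cases hyC : C ≤ k * ‖y - y₀‖
      · have h2 := hδK (z, y) ⟨⟨hz, hy⟩, hzb, hyC⟩
        have h3 := mul_le_mul_of_nonneg_left (hηC z hz) hεpos.le
        simp only at h2 ⊢
        linarith
      · have h2 : η z ≤ χ y := (hηC z hz).trans (le_max_of_le_right (by linarith))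
        have h3 := mul_le_mul_of_nonneg_left h2 hεpos.le
        simp only
        linarith
    · have h2 : η z = 0 := max_eq_left (by linarith)
      simp only [h2]
      linarith
  have hopt := h.maximal _ _ hadm'
  unfold dualFunctional at hopt
  rw [integral_add (hφ.integrableOn_compact hMc)
      ((hηc.const_mul ε).continuousOn.integrableOn_compact hMc),
    integral_sub (hψ.integrableOn_compact hNc)
      ((hχc.const_mul ε).continuousOn.integrableOn_compact hNc),
    integral_const_mul, integral_const_mul] at hopt
  have := mul_lt_mul_of_pos_left hk hεpos
  linarith

theorem IsConjugateOptimalPair.exists_contact {M N : Set (Euc n)} {μ ν : Measure (Euc n)}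
    {φ ψ : Euc n → ℝ} (h : IsConjugateOptimalPair M N μ ν φ ψ) (hN : IsCompact N)
    (hne : N.Nonempty) {x : Euc n} (hx : x ∈ M) : ∃ y ∈ N, φ x + ψ y = cost x y := by
  have hcost : Continuous fun z => cost x z := by unfold cost; fun_prop
  obtain ⟨y, hy, hmin⟩ := hN.exists_isMinOn hne (hcost.continuousOn.sub h.admissible.2.1)
  refine ⟨y, hy, le_antisymm (h.admissible.2.2 x hx y hy) ?_⟩
  have : Nonempty N := hne.to_subtype
  have hle : cost x y - ψ y ≤ φ x := by
    rw [h.eq_conj_right x hx]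
    exact le_ciInf fun z => hmin z.2
  linarith

theorem isMinOn_theta {M N : Set (Euc n)} {φ ψ : Euc n → ℝ} (h : IsAdmissible M N φ ψ)
    {x y : Euc n} (hy : y ∈ N) (hc : φ x + ψ y = cost x y) : IsMinOn (Theta φ y) M x := by
  intro z hz
  have := h.2.2 z hz y hy
  change cost x y - φ x ≤ cost z y - φ z
  linarith

/-- A contact point is obtained from a point maximizing `Θ` by moving it in the outer normal
direction. -/
theorem exists_eq_add_smul_outerNormal {U N : Set (Euc n)} (hU : IsSmoothStrictlyConvexDomain U)
    {φ ψ : Euc n → ℝ} (h : IsAdmissible (frontier U) N φ ψ) {x y y' : Euc n}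
    (hx : x ∈ frontier U) (hmax : IsMaxOn (Theta φ y) (frontier U) x) (hy' : y' ∈ N)
    (hc : φ x + ψ y' = cost x y') : ∃ s : ℝ, 0 ≤ s ∧ y' = y + s • outerNormal U x := by
  obtain ⟨-, -, -, -, hcone⟩ := hU.outerNormal_spec hx
  obtain ⟨s, hs, he⟩ := hcone (y' - y) fun z hz => by
    have h1 : cost z y - φ z ≤ cost x y - φ x := hmax hz
    have h2 := h.2.2 z hz y' hy'
    have h3 := cost_sub_cost z y y'
    have h4 := cost_sub_cost x y y'
    rw [inner_sub_right]
    linarith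
  exact ⟨s, hs, by rw [← he]; abel⟩

theorem normalLine_eq {U : Set (Euc n)} {φ : Euc n → ℝ} {x y : Euc n}
    (h : IsTangentialGradient (frontier U) φ x
      ((x - y) - inner ℝ (outerNormal U x) (x - y) • outerNormal U x)) :
    normalLine U φ x = {z | ∃ t : ℝ, z = y + t • outerNormal U x} := by
  unfold normalLine
  rw [h.tangentialGradient_eq]
  ext z
  constructor
  · rintro ⟨t, rfl⟩
    exact ⟨t + inner ℝ (outerNormal U x) (x - y), by module⟩
  · rintro ⟨t, rfl⟩
    exact ⟨t - inner ℝ (outerNormal U x) (x - y), by module⟩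

theorem continuous_of_isMaxOn_theta_iff {M N : Set (Euc n)} (hN : IsCompact N) {φ : Euc n → ℝ}
    (hφ : ContinuousOn φ M) {T : Gam M N φ → N}
    (hT : ∀ (x : Gam M N φ) (y : N), IsMaxOn (Theta φ y) M x ↔ y = T x) : Continuous T := by
  have : CompactSpace N := isCompact_iff_compactSpace.1 hN
  have hφ' : Continuous fun x : Gam M N φ => φ x :=
    (hφ.mono fun x hx => hx.1).domRestrict
  have hgraph : IsClosed {p : Gam M N φ × N | p.2 = T p.1} := by
    have he : {p : Gam M N φ × N | p.2 = T p.1} = ⋂ z ∈ M, {p : Gam M N φ × N |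
        cost z (p.2 : Euc n) - φ z ≤ cost (p.1 : Euc n) (p.2 : Euc n) - φ p.1} := by
      ext p
      rw [mem_iInter₂]
      exact (hT p.1 p.2).symm
    rw [he]
    refine isClosed_biInter fun z _ => isClosed_le ?_ ?_
    · unfold cost; fun_prop
    · have : Continuous fun p : Gam M N φ × N => φ p.1 := hφ'.comp continuous_fst
      exact (continuous_cost.comp ((continuous_subtype_val.comp continuous_fst).prodMk
        (continuous_subtype_val.comp continuous_snd))).sub this
  refine continuous_iff_isClosed.2 fun C hC => ?_
  have he : T ⁻¹' C = Prod.fst '' ({p : Gam M N φ × N | p.2 = T p.1} ∩ Prod.snd ⁻¹' C) := by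
    ext x
    constructor
    · intro hx
      exact ⟨(x, T x), ⟨rfl, hx⟩, rfl⟩
    · rintro ⟨⟨x', y⟩, ⟨hxy, hy⟩, rfl⟩
      have hxy : y = T x' := hxy
      rw [mem_preimage, ← hxy]
      exact hy
  rw [he]
  exact isClosedMap_fst_of_compactSpace _ (hgraph.inter (hC.preimage continuous_snd))

end QuadraticTransport

open QuadraticTransport in
theorem mainTheorem4 (n : ℕ) (hn : 2 ≤ n)
    (U V : Set (QuadraticTransport.Euc n))
    (hU : QuadraticTransport.IsSmoothStrictlyConvexDomain U)
    (hV : QuadraticTransport.IsSmoothStrictlyConvexDomain V)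
    (M N : Set (QuadraticTransport.Euc n)) (hM : M = frontier U) (hN : N = frontier V)
    (f g : QuadraticTransport.Euc n → ℝ)
    (hf : ContinuousOn f M) (hf_pos : ∀ x ∈ M, 0 < f x)
    (hg : ContinuousOn g N) (hg_pos : ∀ y ∈ N, 0 < g y)
    (μ ν : Measure (QuadraticTransport.Euc n))
    (hμ : μ = QuadraticTransport.densityMeasure M f)
    (hν : ν = QuadraticTransport.densityMeasure N g)
    (hμ_prob : IsProbabilityMeasure μ) (hν_prob : IsProbabilityMeasure ν)
    (φ ψ : QuadraticTransport.Euc n → ℝ)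
    (hφψ : QuadraticTransport.IsConjugateOptimalPair M N μ ν φ ψ) :
    ∃ T : QuadraticTransport.Gam M N φ → N,
      (∀ (x : QuadraticTransport.Gam M N φ) (y : N),
        IsMaxOn (QuadraticTransport.Theta φ y) M x ↔ y = T x) ∧
      Continuous T ∧
      Function.Surjective T ∧
      (∀ x : QuadraticTransport.Gam M N φ,
        inner ℝ (QuadraticTransport.outerNormal U x) (QuadraticTransport.outerNormal V (T x)) < 0) ∧
      (∀ x : QuadraticTransport.Gam M N φ,
        DifferentiableWithinAt ℝ φ M x ∧
        ∃ y' : QuadraticTransport.Euc n, y' ≠ T x ∧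
          QuadraticTransport.normalLine U φ x ∩ N = {(T x : QuadraticTransport.Euc n), y'} ∧
          IsMinOn (QuadraticTransport.Theta φ y') M x ∧
          0 < inner ℝ (QuadraticTransport.outerNormal U x)
            (QuadraticTransport.outerNormal V y')) := by
  subst hM hN hμ hν
  have hadm := hφψ.admissible
  have hMc := hU.isCompact_frontier
  have hNc := hV.isCompact_frontier
  have hMne := hU.frontier_nonempty (by omega)
  have hNne := hV.frontier_nonempty (by omega)
  have hkey : ∀ x ∈ frontier U, ∀ y ∈ frontier V, IsMaxOn (Theta φ y) (frontier U) x →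
      ∀ y' ∈ frontier V, φ x + ψ y' = cost x y' →
        ∃ s : ℝ, 0 < s ∧ y' = y + s • outerNormal U x := by
    intro x hx y hy hmax y' hy' hc
    obtain ⟨s, hs, he⟩ := exists_eq_add_smul_outerNormal hU hadm hx hmax hy' hc
    refine ⟨s, hs.lt_of_ne ?_, he⟩
    rintro rfl
    rw [zero_smul, add_zero] at he
    subst he
    refine hφψ.not_forall_add_eq_cost hn hU hV hf hf_pos hy fun z hz => ?_
    have h1 : cost z y' - φ z ≤ cost x y' - φ x := hmax hz
    linarith [hadm.2.2 z hz y' hy]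
  have hn0 : ∀ x ∈ frontier U, outerNormal U x ≠ 0 := fun x hx h0 => by
    have := (hU.outerNormal_spec hx).1
    rw [h0] at this
    simp at this
  have huniq : ∀ x ∈ frontier U, ∀ y₁ ∈ frontier V, ∀ y₂ ∈ frontier V,
      IsMaxOn (Theta φ y₁) (frontier U) x → IsMaxOn (Theta φ y₂) (frontier U) x → y₂ = y₁ := by
    intro x hx y₁ hy₁ y₂ hy₂ h₁ h₂
    obtain ⟨y', hy', hc⟩ := hφψ.exists_contact hNc hNne hx
    obtain ⟨s₁, hs₁, he₁⟩ := hkey x hx y₁ hy₁ h₁ y' hy' hc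
    obtain ⟨s₂, hs₂, he₂⟩ := hkey x hx y₂ hy₂ h₂ y' hy' hc
    have he : y₂ = y₁ + (s₁ - s₂) • outerNormal U x := by
      rw [sub_smul, ← add_sub_assoc, ← he₁, he₂]
      abel
    rcases hV.eq_zero_or_eq_of_mem_line (hn0 x hx) hs₁ hy₁ (he₁ ▸ hy') (he ▸ hy₂) with h | h
    · rw [he, h, zero_smul, add_zero]
    · linarith
  choose T₀ hT₀N hT₀ using fun x : Gam (frontier U) (frontier V) φ => x.2.2
  have hT : ∀ (x : Gam (frontier U) (frontier V) φ) (y : frontier V),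
      IsMaxOn (Theta φ y) (frontier U) x ↔ y = (⟨T₀ x, hT₀N x⟩ : frontier V) := by
    intro x y
    constructor
    · intro h
      exact Subtype.ext (huniq x x.2.1 _ (hT₀N x) _ y.2 (hT₀ x) h)
    · rintro rfl
      exact hT₀ x
  have hsign : ∀ (y w : Euc n) (s : ℝ), 0 < s → w ≠ 0 → y ∈ frontier V →
      y + s • w ∈ frontier V →
        inner ℝ w (outerNormal V y) < 0 ∧ 0 < inner ℝ w (outerNormal V (y + s • w)) := by
    intro y w s hs hw hy hy'
    have hne : s • w ≠ 0 := smul_ne_zero hs.ne' hw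
    have h1 := hV.inner_outerNormal_neg hy (frontier_subset_closure hy')
      (by simpa using hne)
    have h2 := hV.inner_outerNormal_neg hy' (frontier_subset_closure hy)
      (by simpa using hne)
    rw [add_sub_cancel_left, inner_smul_right, real_inner_comm] at h1
    rw [sub_add_cancel_left, inner_neg_right, inner_smul_right, real_inner_comm] at h2
    exact ⟨by by_contra! h; nlinarith [mul_nonneg hs.le h],
      by by_contra! h; nlinarith [mul_nonneg hs.le (neg_nonneg.2 h)]⟩
  refine ⟨fun x => ⟨T₀ x, hT₀N x⟩, hT, continuous_of_isMaxOn_theta_iff hNc hadm.1 hT, ?_, ?_, ?_⟩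
  · intro y
    have hΘ : ContinuousOn (Theta φ y) (frontier U) := by
      have : Continuous fun x => cost x (y : Euc n) := by unfold cost; fun_prop
      exact this.continuousOn.sub hadm.1
    obtain ⟨x, hx, hmax⟩ := hMc.exists_isMaxOn hMne hΘ
    exact ⟨⟨x, hx, y, y.2, hmax⟩, ((hT ⟨x, hx, y, y.2, hmax⟩ y).1 hmax).symm⟩
  · intro x
    obtain ⟨y', hy', hc⟩ := hφψ.exists_contact hNc hNne x.2.1
    obtain ⟨s, hs, rfl⟩ := hkey x x.2.1 _ (hT₀N x) (hT₀ x) y' hy' hc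
    exact (hsign _ _ s hs (hn0 x x.2.1) (hT₀N x) hy').1
  · intro x
    obtain ⟨y', hy', hc⟩ := hφψ.exists_contact hNc hNne x.2.1
    obtain ⟨s, hs, rfl⟩ := hkey x x.2.1 _ (hT₀N x) (hT₀ x) y' hy' hc
    have hgrad := hU.isTangentialGradient_of_squeeze (φ := φ) (y := T₀ x) (s := s) x.2.1
      (fun z hz => by
        have : cost z (T₀ x) - φ z ≤ cost x (T₀ x) - φ x := hT₀ x hz
        linarith)
      (fun z hz => by linarith [hadm.2.2 z hz _ hy'])
    have hne : s • outerNormal U (x : Euc n) ≠ 0 := smul_ne_zero hs.ne' (hn0 x x.2.1)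
    refine ⟨(hasGradientWithinAt_iff_hasFDerivWithinAt.1 hgrad.2).differentiableWithinAt,
      T₀ x + s • outerNormal U (x : Euc n), by simpa using hne, ?_,
      isMinOn_theta hadm hy' hc, (hsign _ _ s hs (hn0 x x.2.1) (hT₀N x) hy').2⟩
    rw [normalLine_eq hgrad]
    ext z
    constructor
    · rintro ⟨⟨t, rfl⟩, ht⟩
      rcases hV.eq_zero_or_eq_of_mem_line (hn0 x x.2.1) hs (hT₀N x) hy' ht with rfl | rfl
      · left; simp
      · right; rfl
    · rintro (rfl | rfl)
      · exact ⟨⟨0, by simp⟩, hT₀N x⟩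
      · exact ⟨⟨s, rfl⟩, hy'⟩
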